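/- Let $G=(V,E,c)$ be a finite undirected graph with positive real edge costs $c$ and $n=|V|\ge 2$. For distinct $s,t\in V$ let $\mathcal{SC}(s,t)\subseteq V$, the source community (SC) of $s$ with respect to $t$, denote the side containing $s$ of the minimum $s$-$t$-cut that minimizes the number of vertices on the side containing $s$. Let $M(G)=\{\mathcal{SC}(s,t): s,t\in V,\ s\ne t\}$ be the set of maximal SCs, i.e. of the SCs with respect to single vertices. A special cut tree of $G$ is a rooted weighted tree on $V$, with edges directed away from the root, such that for each edge $(t,s)$ the component containing $s$ of the tree without this edge is $\mathcal{SC}(s,t)$, the weight of the edge is the cost of this cut, and $|\mathcal{SC}(s,t)|\le|\mathcal{SC}(t,s)|$. The edge $(t,s)$ is said to give the SC $\mathcal{SC}(s,t)$, and $\mathcal{SC}(t,s)$ is the opposite SC associated with it. Then: 1. $n\le |M(G)|\le 2(n-1)$. 2. A special cut tree of $G$ exists, and for each special cut tree of $G$ the set $M(G)$ consists exactly of the SCs given by its edges and of the opposite SCs associated with its edges. 3. $M(G)$ can be constructed with at most $2(n-1)$ max-flow computations. More precisely, for each finite vertex set $V$ with $n=|V|\ge 2$ there is an adaptive algorithm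 which, for every graph $G$ on $V$, outputs $M(G)$ after at most $2(n-1)$ max-flow computations, where the only access to $G$ is by max-flow computations in $G$: a computation for a pair $s\ne t$ returns the set of the vertices reachable from $s$, and the set of the vertices from which $t$ is reachable, in the residual network of some maximum $s$-$t$-flow. -/

import Mathlib

/-- A finite undirected weighted graph `G = (V, E, c)` with positive edge costs. -/
structure WeightedGraph (V : Type*) where
  /-- the edges -/
  graph : SimpleGraph V
  /-- the edge cost function (its values off the edge set play no role) -/
  cost : Sym2 V → ℝ
  cost_pos : ∀ e ∈ graph.edgeSet, 0 < cost e

namespace WeightedGraph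

variable {V : Type*}

open Classical in
/-- The cost `c(u, v)` of the edge `{u, v}`, and `0` if `{u, v}` is not an edge. -/
noncomputable def cap (G : WeightedGraph V) (u v : V) : ℝ :=
  if G.graph.Adj u v then G.cost s(u, v) else 0

variable [Fintype V] [DecidableEq V]

/-- The cost `c(S, V \ S)` of the cut with cut sides `S` and `V \ S`: the sum of the costs of all
edges crossing it. -/
noncomputable def cutCost (G : WeightedGraph V) (S : Finset V) : ℝ :=
  ∑ u ∈ S, ∑ v ∈ Sᶜ, G.cap u v

/-- `(S, V \ S)` is a minimum `A`-`B`-cut, with `A` on the side `S`. -/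
def IsMinCut (G : WeightedGraph V) (A B S : Finset V) : Prop :=
  A ⊆ S ∧ Disjoint S B ∧
    ∀ S' : Finset V, A ⊆ S' → Disjoint S' B → G.cutCost S ≤ G.cutCost S'

/-- `S` is the source community of `s` with respect to `T`: `(S, V \ S)` is a minimum `s`-`T`-cut
that minimizes the number of vertices on the side containing `s`. -/
def IsSC (G : WeightedGraph V) (s : V) (T S : Finset V) : Prop :=
  G.IsMinCut {s} T S ∧ ∀ S' : Finset V, G.IsMinCut {s} T S' → S.card ≤ S'.card

open Classical in
/-- The set `M(G)` of maximal source communities: the source communities with respect to single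
vertices. -/
noncomputable def maximalSCs (G : WeightedGraph V) : Finset (Finset V) :=
  Finset.univ.filter fun S => ∃ s t : V, s ≠ t ∧ G.IsSC s {t} S

end WeightedGraph

open Classical in
/-- For an edge `{t, s}` of a tree `T`, the vertex set of that connected component of `T - {t, s}`
which contains `s`. -/
noncomputable def treeSide {V : Type*} [Fintype V] (T : SimpleGraph V) (t s : V) : Finset V :=
  Finset.univ.filter fun v => (T.deleteEdges {s(t, s)}).Reachable s v

/-- A cut tree of `G`: a weighted tree on the vertices of `G` (whose edges need not be edges of
`G`) each of whose edges `{s, t}` induces a minimum `s`-`t`-cut of `G`, by decomposing the tree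
into two connected components, and has the cost of the induced cut as its weight. -/
structure CutTree {V : Type*} [Fintype V] [DecidableEq V] (G : WeightedGraph V) where
  tree : SimpleGraph V
  isTree : tree.IsTree
  weight : Sym2 V → ℝ
  isMinCut : ∀ t s : V, tree.Adj t s → G.IsMinCut {s} {t} (treeSide tree t s)
  weight_eq : ∀ t s : V, tree.Adj t s → weight s(t, s) = G.cutCost (treeSide tree t s)

/-- The special cut tree: a rooted cut tree, with edges directed away from the root, such that each
directed edge `(t, s)` represents the source community of `s` with respect to `t`, which is
not larger than the opposite one, the source community of `t` with respect to `s`. -/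
structure SpecialCutTree {V : Type*} [Fintype V] [DecidableEq V] (G : WeightedGraph V)
    extends CutTree G where
  root : V
  isSC : ∀ t s : V, tree.Adj t s → tree.dist root s = tree.dist root t + 1 →
    G.IsSC s {t} (treeSide tree t s)
  card_le : ∀ t s : V, tree.Adj t s → tree.dist root s = tree.dist root t + 1 →
    ∀ S : Finset V, G.IsSC t {s} S → (treeSide tree t s).card ≤ S.card

/-- `(t, s)` is a directed edge of the special cut tree. -/
def SpecialCutTree.IsArc {V : Type*} [Fintype V] [DecidableEq V] {G : WeightedGraph V}
    (T : SpecialCutTree G) (t s : V) : Prop :=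
  T.tree.Adj t s ∧ T.tree.dist T.root s = T.tree.dist T.root t + 1

namespace WeightedGraph

variable {V : Type*} [Fintype V]

/-- `f` is an `s`-`t`-flow in `G`; `f u v` is the net flow from `u` to `v`. -/
structure IsFlow (G : WeightedGraph V) (s t : V) (f : V → V → ℝ) : Prop where
  antisymm : ∀ u v, f u v = - f v u
  le_cap : ∀ u v, f u v ≤ G.cap u v
  conservation : ∀ v, v ≠ s → v ≠ t → ∑ w, f v w = 0

/-- `f` is a maximum `s`-`t`-flow: its value, the net flow out of `s`, is the largest possible. -/
def IsMaxFlow (G : WeightedGraph V) (s t : V) (f : V → V → ℝ) : Prop :=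
  G.IsFlow s t f ∧ ∀ g : V → V → ℝ, G.IsFlow s t g → ∑ w, g s w ≤ ∑ w, f s w

/-- There is a path from `u` to `v` in the residual network of the flow `f`. -/
def ResidualPath (G : WeightedGraph V) (f : V → V → ℝ) (u v : V) : Prop :=
  Relation.ReflTransGen (fun x y => f x y < G.cap x y) u v

/-- `(A, B)` is the answer of a max-flow computation for `s` and `t`: for a maximum `s`-`t`-flow,
`A` is the set of the vertices that can be reached from `s` in the residual network, and `B` is
the set of the vertices from which `t` can be reached. -/
def IsMaxFlowAnswer (G : WeightedGraph V) (s t : V) (A B : Finset V) : Prop :=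
  ∃ f : V → V → ℝ, G.IsMaxFlow s t f ∧
    (∀ v, v ∈ A ↔ G.ResidualPath f s v) ∧ (∀ v, v ∈ B ↔ G.ResidualPath f v t)

end WeightedGraph

/-- An adaptive algorithm that returns a family of vertex sets. It knows the vertex set `V`, and it
has access to the weighted graph on `V` only by max-flow computations: it either stops with
an output, or requests a max-flow computation for two distinct vertices and goes on as
determined by the answer. -/
inductive MaxFlowAlgorithm (V : Type*) where
  | output (F : Finset (Finset V)) : MaxFlowAlgorithm V
  | maxFlow (s t : V) (hst : s ≠ t) (next : Finset V → Finset V → MaxFlowAlgorithm V) :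
      MaxFlowAlgorithm V

namespace MaxFlowAlgorithm

variable {V : Type*} [Fintype V]

/-- `Run G a k F`: on the graph `G`, the algorithm `a` can output `F` after exactly `k` max-flow
computations. -/
inductive Run (G : WeightedGraph V) : MaxFlowAlgorithm V → ℕ → Finset (Finset V) → Prop where
  | output (F : Finset (Finset V)) : Run G (.output F) 0 F
  | maxFlow (s t : V) (hst : s ≠ t) (next : Finset V → Finset V → MaxFlowAlgorithm V)
      (A B : Finset V) (k : ℕ) (F : Finset (Finset V)) :
      G.IsMaxFlowAnswer s t A B → Run G (next A B) k F → Run G (.maxFlow s t hst next) (k + 1) F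

/-- On the graph `G`, the algorithm `a` has a run, and each of its runs outputs `F` after at most
`b` max-flow computations. -/
def Constructs (a : MaxFlowAlgorithm V) (G : WeightedGraph V) (F : Finset (Finset V)) (b : ℕ) :
    Prop :=
  (∃ k F', Run G a k F') ∧ ∀ k F', Run G a k F' → F' = F ∧ k ≤ b

end MaxFlowAlgorithm

/-! Every maximal SC already lives on a tree edge. For any cut tree and S = SC(s,t), the tree path
from s to t contains an edge {a,b} with S = SC(a,b) (`CutTree.mem_maximalSCs_iff`). So M(G) consists
of the two SCs of each edge of any cut tree, whence the bound 2(n-1). In a special cut tree the n-1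
directed edges give distinct SCs avoiding the root, and any SC of the root is one more, whence the
bound n.

Cut trees are built by Gusfield's method. Start from a star; for each leaf v take any minimum cut X
between v and its neighbour r, and move the neighbours of r that lie in X over to v. Uncrossing
(`exists_uncrossed`, `IsPartialCutTree.split`) shows that the new tree edge represents a minimum cut
and that the processed edges continue to do so. This works for every symmetric submodular function
with values in a linearly ordered abelian group, and it is used twice.

For existence of a special cut tree, the cut cost is refined lexicographically by |S||V \ S|. The
cuts of the tree are then as unbalanced as possible, so the smaller side of each is the smaller of
the two SCs; a centroid as root directs all edges towards their smaller sides.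

For the algorithm, the plain cut cost is used: n-1 max-flows build a cut tree, and n-1 more, one per
edge, yield both SCs of each edge, because the two sets returned for s and t are exactly SC(s,t) and
SC(t,s) (`WeightedGraph.IsMaxFlowAnswer.isSC`). -/

/-! ### Symmetric submodular functions and uncrossing -/

/-- A symmetric submodular set function. -/
structure IsSymmSubmodular {V α : Type*} [Fintype V] [DecidableEq V] [Add α] [LE α]
    (f : Finset V → α) : Prop where
  compl : ∀ S, f Sᶜ = f S
  inter_add_union : ∀ A B, f (A ∩ B) + f (A ∪ B) ≤ f A + f B

/-- The set `S` minimizes `f` among the sets that contain `s` and do not contain `t`. -/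
def IsMinSep {V α : Type*} [LE α] (f : Finset V → α) (s t : V) (S : Finset V) : Prop :=
  s ∈ S ∧ t ∉ S ∧ ∀ S' : Finset V, s ∈ S' → t ∉ S' → f S ≤ f S'

section Submodular

variable {V α : Type*} [Fintype V] [DecidableEq V]

/-- As a sum over all ordered pairs with an indicator of being cut, the inequality can be checked
pair by pair. It serves both the cut cost and, with unit weights, the tie-breaker |S||V \ S|. -/
theorem isSymmSubmodular_sum_sum_compl {w : V → V → ℝ} (hw : ∀ u v, w u v = w v u)
    (hw0 : ∀ u v, 0 ≤ w u v) :
    IsSymmSubmodular fun S : Finset V => ∑ u ∈ S, ∑ v ∈ Sᶜ, w u v where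
  compl S := by
    rw [compl_compl, Finset.sum_comm]
    simp only [hw]
  inter_add_union A B := by
    have key : ∀ S : Finset V, ∑ u ∈ S, ∑ v ∈ Sᶜ, w u v =
        ∑ u, ∑ v, if u ∈ S ∧ v ∉ S then w u v else 0 := by
      intro S
      rw [← Finset.sum_filter_add_sum_filter_not Finset.univ (· ∈ S)]
      rw [Finset.sum_eq_zero (s := Finset.univ.filter (· ∉ S)), add_zero]
      · simp only [Finset.filter_univ_mem]
        refine Finset.sum_congr rfl fun u hu => ?_
        rw [← Finset.sum_filter]
        refine Finset.sum_congr ?_ fun _ _ => rfl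
        ext v; simp [hu]
      · intro u hu
        have : u ∉ S := by simpa using hu
        simp [this]
    simp only [key, ← Finset.sum_add_distrib]
    refine Finset.sum_le_sum fun u _ => Finset.sum_le_sum fun v _ => ?_
    have := hw0 u v
    by_cases h1 : u ∈ A <;> by_cases h2 : u ∈ B <;> by_cases h3 : v ∈ A <;> by_cases h4 : v ∈ B <;>
      simp [*]

theorem exists_isMinSep [LinearOrder α] (f : Finset V → α) {s t : V} (h : s ≠ t) : ∃ S, IsMinSep f s t S := by
  obtain ⟨S, hS, hmin⟩ := Finset.exists_min_image
    (Finset.univ.filter fun S : Finset V => s ∈ S ∧ t ∉ S) f ⟨{s}, by simp [h.symm]⟩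
  simp only [Finset.mem_filter, Finset.mem_univ, true_and] at hS hmin
  exact ⟨S, hS.1, hS.2, fun S' h1 h2 => hmin S' ⟨h1, h2⟩⟩

variable [AddCommGroup α] [LinearOrder α] {f : Finset V → α}

theorem IsSymmSubmodular.sdiff_add_sdiff (hf : IsSymmSubmodular f) (A B : Finset V) :
    f (A \ B) + f (B \ A) ≤ f A + f B := by
  have h := hf.inter_add_union A Bᶜ
  have h1 : A ∩ Bᶜ = A \ B := by ext; simp
  have h2 : A ∪ Bᶜ = (B \ A)ᶜ := by ext; simp; tauto
  rwa [h1, h2, hf.compl, hf.compl] at h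

theorem IsMinSep.compl (hf : IsSymmSubmodular f) {s t : V} {S : Finset V}
    (h : IsMinSep f s t S) : IsMinSep f t s Sᶜ := by
  refine ⟨by simpa using h.2.1, by simpa using h.1, fun S' h1 h2 => ?_⟩
  rw [hf.compl, ← hf.compl S']
  exact h.2.2 _ (by simpa using h2) (by simpa using h1)

theorem IsMinSep.compl_iff (hf : IsSymmSubmodular f) {s t : V} {S : Finset V} :
    IsMinSep f t s Sᶜ ↔ IsMinSep f s t S :=
  ⟨fun h => by simpa using h.compl hf, fun h => h.compl hf⟩

variable [IsOrderedAddMonoid α]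

/-- The union S ∪ W still separates a from b, so it costs at least as much as W; submodularity then
leaves at most the cost of S for the intersection. -/
theorem IsMinSep.inter (hf : IsSymmSubmodular f) {s t a b : V} {S W : Finset V}
    (hS : IsMinSep f s t S) (hW : IsMinSep f a b W) (hs : s ∈ W) (ha : a ∈ S) (hb : b ∉ S) :
    IsMinSep f s t (S ∩ W) := by
  refine ⟨by simp [hs, hS.1], by simp [hS.2.1], fun S' h1 h2 => ?_⟩
  have h3 := hf.inter_add_union S W
  have h4 : f W ≤ f (S ∪ W) := hW.2.2 _ (by simp [ha]) (by simp [hb, hW.2.1])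
  have h5 : f (S ∩ W) ≤ f S := by
    by_contra! h6
    exact (add_lt_add_of_lt_of_le h6 h4).not_ge h3
  exact h5.trans (hS.2.2 _ h1 h2)

/-- A cut separating `v` from `r` can be made to respect disjoint minimum cuts separating other
vertices from `r`, without increasing its value. -/
theorem exists_uncrossed (hf : IsSymmSubmodular f) {ι : Type*} [DecidableEq ι] {r v : V}
    (J : Finset ι)
    (w : ι → V) (B : ι → Finset V) (hmin : ∀ i ∈ J, IsMinSep f (w i) r (B i))
    (hdisj : ∀ i ∈ J, ∀ j ∈ J, i ≠ j → Disjoint (B i) (B j)) (hv : ∀ i ∈ J, v ∉ B i)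
    {X : Finset V} (hvX : v ∈ X) (hrX : r ∉ X) :
    ∃ Y : Finset V, f Y ≤ f X ∧ v ∈ Y ∧ r ∉ Y ∧
      (∀ x, (∀ i ∈ J, x ∉ B i) → (x ∈ Y ↔ x ∈ X)) ∧ ∀ i ∈ J, ∀ x ∈ B i, (x ∈ Y ↔ w i ∈ X) := by
  induction J using Finset.induction_on with
  | empty => exact ⟨X, le_rfl, hvX, hrX, by simp, by simp⟩
  | insert k J hk ih =>
    obtain ⟨Y, hYX, hvY, hrY, hY1, hY2⟩ := ih (fun i hi => hmin i (by simp [hi]))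
      (fun i hi j hj => hdisj i (by simp [hi]) j (by simp [hj])) (fun i hi => hv i (by simp [hi]))
    obtain ⟨hk1, hk2, hk3⟩ := hmin k (by simp)
    have hvk := hv k (by simp)
    have hdk : ∀ i ∈ J, ∀ x ∈ B k, x ∉ B i := fun i hi x hx hx' =>
      Finset.disjoint_left.1 (hdisj k (by simp) i (by simp [hi]) (by rintro rfl; exact hk hi)) hx hx'
    have hkY : w k ∈ Y ↔ w k ∈ X := hY1 _ fun i hi => hdk i hi _ hk1
    -- The position of `w k` decides the fate of `B k`. If `w k` is in `X`, then `Y ∩ B k` separates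
    -- it from `r`, so absorbing `B k` costs nothing; otherwise `B k \ Y` does, and removing `B k`
    -- costs nothing.
    by_cases hX : w k ∈ X
    · refine ⟨Y ∪ B k, ?_, by simp [hvY], by simp [hrY, hk2], ?_, ?_⟩
      · have h3 := hf.inter_add_union Y (B k)
        have h4 : f (B k) ≤ f (Y ∩ B k) := hk3 _ (by simp [hk1, hkY, hX]) (by simp [hk2])
        by_contra! h6
        have := add_lt_add_of_le_of_lt h4 (hYX.trans_lt h6)
        rw [add_comm (f (B k))] at this
        exact this.not_ge h3
      · intro x hx
        have := hY1 x fun i hi => hx i (by simp [hi])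
        have := hx k (by simp)
        simp [*]
      · intro i hi x hx
        rcases Finset.mem_insert.1 hi with rfl | hi
        · simp [hx, hX]
        · have : x ∉ B k := fun h => hdk i hi x h hx
          simp [this, hY2 i hi x hx]
    · refine ⟨Y \ B k, ?_, by simp [hvY, hvk], by simp [hrY], ?_, ?_⟩
      · have h3 := hf.sdiff_add_sdiff Y (B k)
        have h4 : f (B k) ≤ f (B k \ Y) := hk3 _ (by simp [hk1, hkY, hX]) (by simp [hk2])
        by_contra! h6
        exact (add_lt_add_of_lt_of_le (hYX.trans_lt h6) h4).not_ge h3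
      · intro x hx
        have := hY1 x fun i hi => hx i (by simp [hi])
        have := hx k (by simp)
        simp [*]
      · intro i hi x hx
        rcases Finset.mem_insert.1 hi with rfl | hi
        · simp [hx, hX]
        · have : x ∉ B k := fun h => hdk i hi x h hx
          simp [this, hY2 i hi x hx]

end Submodular

/-! ### Building a cut tree by splitting leaves -/

section EdgeArray

variable {V α : Type*} [Fintype V] [DecidableEq V]

/-- The edges `{a i, b i}`, `i ≠ ρ`, form a tree on `V`, and `D i` is the vertex set of the
component containing `b i` after the removal of the edge with index `i`. -/
structure IsEdgeTree (ρ : V) (a b : V → V) (D : V → Finset V) : Prop where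
  mem : ∀ i, i ≠ ρ → b i ∈ D i
  notMem : ∀ i, i ≠ ρ → a i ∉ D i
  mem_iff : ∀ i, i ≠ ρ → ∀ j, j ≠ ρ → j ≠ i → (a j ∈ D i ↔ b j ∈ D i)
  conn : ∀ S : Finset V, (∀ i, i ≠ ρ → (a i ∈ S ↔ b i ∈ S)) → ∀ x ∈ S, ∀ y, y ∈ S

/-- An intermediate state of the construction of a cut tree: the vertices in `U` are leaves whose
edges do not yet represent minimum cuts. -/
structure IsPartialCutTree [LE α] (f : Finset V → α) (ρ : V) (U : Finset V) (a b : V → V)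
    (D : V → Finset V) : Prop extends IsEdgeTree ρ a b D where
  ne_root : ∀ i ∈ U, i ≠ ρ
  head_eq : ∀ i ∈ U, b i = i
  side_eq : ∀ i ∈ U, D i = {i}
  ne_of_mem : ∀ i ∈ U, ∀ j, j ≠ ρ → j ≠ i → a j ≠ i ∧ b j ≠ i
  isMinSep : ∀ i, i ≠ ρ → i ∉ U → IsMinSep f (b i) (a i) (D i)

/-- The tails of the edges after splitting the vertex `a v` by the set `X`. -/
def splitTail (v : V) (X : Finset V) (a b : V → V) (i : V) : V :=
  if i ≠ v ∧ a i = a v ∧ b i ∈ X then v else a i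

/-- The heads of the edges after splitting the vertex `a v` by the set `X`. -/
def splitHead (v : V) (X : Finset V) (a b : V → V) (i : V) : V :=
  if i ≠ v ∧ b i = a v ∧ a i ∈ X then v else b i

theorem isPartialCutTree_star [LE α] (f : Finset V → α) (ρ : V) :
    IsPartialCutTree f ρ (Finset.univ.erase ρ) (fun _ => ρ) id (fun i => {i}) where
  mem := by simp
  notMem := by simp +contextual [eq_comm]
  mem_iff := by simp +contextual [eq_comm]
  conn S hS x hx y := by
    have h : ∀ z, ρ ∈ S ↔ z ∈ S := fun z => by
      by_cases hz : z = ρ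
      · rw [hz]
      · exact hS z hz
    exact (h y).1 ((h x).2 hx)
  ne_root := by simp
  head_eq := by simp
  side_eq := by simp
  ne_of_mem := by simp +contextual [eq_comm]
  isMinSep := by simp +contextual

namespace IsEdgeTree

variable {ρ : V} {a b : V → V} {D : V → Finset V}

/-- The neighbour of `r` along the edge `i`. -/
def other (a b : V → V) (r i : V) : V := if a i = r then b i else a i

/-- The component not containing `r` after the removal of the edge `i` at `r`. -/
def branch (a : V → V) (D : V → Finset V) (r i : V) : Finset V := if a i = r then D i else (D i)ᶜ

variable {r : V}

theorem notMem_branch (h : IsEdgeTree ρ a b D) {i : V} (hi : i ≠ ρ) (hr : a i = r ∨ b i = r) :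
    r ∉ branch a D r i := by
  have := h.mem i hi
  have := h.notMem i hi
  grind [branch, Finset.mem_compl]

theorem other_mem_branch (h : IsEdgeTree ρ a b D) {i : V} (hi : i ≠ ρ) :
    other a b r i ∈ branch a D r i := by
  have := h.mem i hi
  have := h.notMem i hi
  grind [branch, other, Finset.mem_compl]

theorem mem_branch_iff (h : IsEdgeTree ρ a b D) {i j : V} (hi : i ≠ ρ) (hj : j ≠ ρ) (hij : j ≠ i) :
    a j ∈ branch a D r i ↔ b j ∈ branch a D r i := by
  have := h.mem_iff i hi j hj hij
  grind [branch, Finset.mem_compl]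

/-- No edge leaves the intersection of two branches at `r`, so by connectedness a common vertex
would force `r` into it. -/
theorem disjoint_branch (h : IsEdgeTree ρ a b D) {i j : V} (hi : i ≠ ρ) (hj : j ≠ ρ) (hij : i ≠ j)
    (hri : a i = r ∨ b i = r) (hrj : a j = r ∨ b j = r) :
    Disjoint (branch a D r i) (branch a D r j) := by
  rw [Finset.disjoint_left]
  intro x hxi hxj
  have h1 := h.notMem_branch hi hri
  have h2 := h.notMem_branch hj hrj
  have h3 := h.mem_branch_iff (r := r) hi hj hij.symm
  have h4 := h.mem_branch_iff (r := r) hj hi hij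
  have := h.conn (branch a D r i ∩ branch a D r j) (fun k hk => by
    by_cases hki : k = i
    · subst hki; simp only [Finset.mem_inter]; grind
    by_cases hkj : k = j
    · subst hkj; simp only [Finset.mem_inter]; grind
    simp only [Finset.mem_inter, h.mem_branch_iff hi hk hki, h.mem_branch_iff hj hk hkj])
    x (by simp [hxi, hxj]) r
  simp [h1] at this

/-- The vertex `r` together with its branches is closed under all edges, hence is everything. -/
theorem exists_mem_branch (h : IsEdgeTree ρ a b D) {x : V} (hx : x ≠ r) :
    ∃ i, i ≠ ρ ∧ (a i = r ∨ b i = r) ∧ x ∈ branch a D r i := by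
  classical
  have := h.conn (insert r (Finset.univ.filter fun x =>
    ∃ i, i ≠ ρ ∧ (a i = r ∨ b i = r) ∧ x ∈ branch a D r i)) (fun k hk => by
      by_cases hkr : a k = r ∨ b k = r
      · have := h.other_mem_branch (r := r) hk
        grind [other]
      · push Not at hkr
        simp only [Finset.mem_insert, hkr.1, hkr.2, false_or, Finset.mem_filter, Finset.mem_univ,
          true_and]
        refine exists_congr fun i => and_congr_right fun hi => and_congr_right fun hir => ?_
        exact h.mem_branch_iff hi hk (by grind)) r (by simp) x
  simpa [hx] using this

end IsEdgeTree

-- One step of Gusfield's construction. The cut `X` may cross earlier cuts, but it can be replaced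
-- by an equally cheap `Y` that contains or omits each other branch at `r = a v` as a whole and
-- agrees with `X` on the neighbours of `r`. Hence moving the neighbours in `X` over to `v` makes
-- `Y` the side of the edge `v`. The new tails and heads depend on `X` only; `Y` and the sides `D`
-- are needed for correctness alone.
open IsEdgeTree in
theorem IsPartialCutTree.split [AddCommGroup α] [LinearOrder α] [IsOrderedAddMonoid α]
    {f : Finset V → α} (hf : IsSymmSubmodular f) {ρ : V} {U : Finset V} {a b : V → V}
    {D : V → Finset V} (h : IsPartialCutTree f ρ U a b D) {v : V} (hv : v ∈ U) {X : Finset V}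
    (hX : IsMinSep f v (a v) X) :
    ∃ D', IsPartialCutTree f ρ (U.erase v) (splitTail v X a b) (splitHead v X a b) D' := by
  classical
  have hvρ := h.ne_root v hv
  have hbv := h.head_eq v hv
  have hDv := h.side_eq v hv
  have hleaf := h.ne_of_mem v hv
  have hT := h.toIsEdgeTree
  have hvr : a v ≠ v := by simpa [hDv] using hT.notMem v hvρ
  obtain ⟨r, hr⟩ : ∃ r, r = a v := ⟨_, rfl⟩
  rw [← hr] at hX hvr
  have hvB : ∀ i, i ≠ ρ → i ≠ v → (a i = r ∨ b i = r) → v ∉ branch a D r i := by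
    intro i hi hiv hir
    have h1 := hT.mem_branch_iff (r := r) hi hvρ hiv.symm
    rw [← hr, hbv] at h1
    exact fun h2 => hT.notMem_branch hi hir (h1.2 h2)
  have hvD : ∀ i, i ≠ ρ → i ≠ v → (r ∈ D i ↔ v ∈ D i) := by
    intro i hi hiv
    have h1 := hT.mem_iff i hi v hvρ hiv.symm
    rwa [← hr, hbv] at h1
  -- Only processed edges are uncrossed, since only their sides are known to be minimum cuts.
  obtain ⟨Y, hYX, hvY, hrY, hY1, hY2⟩ := exists_uncrossed hf (r := r) (v := v)
    (Finset.univ.filter fun i => i ≠ ρ ∧ i ∉ U ∧ (a i = r ∨ b i = r)) (other a b r) (branch a D r)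
    (by
      intro i hi
      simp only [Finset.mem_filter, Finset.mem_univ, true_and] at hi
      obtain ⟨hi1, hi2, hi3⟩ := hi
      have := h.isMinSep i hi1 hi2
      unfold other branch
      split_ifs with hai
      · rwa [hai] at this
      · rw [hi3.resolve_left hai] at this
        exact this.compl hf)
    (by
      intro i hi j hj hij
      simp only [Finset.mem_filter, Finset.mem_univ, true_and] at hi hj
      exact hT.disjoint_branch hi.1 hj.1 hij hi.2.2 hj.2.2)
    (by
      intro i hi
      simp only [Finset.mem_filter, Finset.mem_univ, true_and] at hi
      exact hvB i hi.1 (by rintro rfl; exact hi.2.1 hv) hi.2.2)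
    hX.1 hX.2.1
  -- Unprocessed edges need no uncrossing: their branches at `r` are single leaves, on which `Y`
  -- agrees with `X`.
  have hY : ∀ i, i ≠ ρ → i ≠ v → (a i = r ∨ b i = r) → ∀ x ∈ branch a D r i,
      (x ∈ Y ↔ other a b r i ∈ X) := by
    intro i hi hiv hir x hx
    by_cases hiU : i ∈ U
    · have h1 := h.ne_of_mem i hiU v hvρ hiv.symm
      have h2 := h.head_eq i hiU
      have h3 := h.side_eq i hiU
      have h4 : a i = r := by grind
      have h5 : other a b r i = i := by simp [other, h4, h2]
      have h6 : x = i := by simpa [branch, h4, h3] using hx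
      rw [h5, h6]
      refine hY1 i fun j hj hij => ?_
      simp only [Finset.mem_filter, Finset.mem_univ, true_and] at hj
      exact Finset.disjoint_left.1 (hT.disjoint_branch hi hj.1 (by grind) hir hj.2.2) (h6 ▸ hx) hij
    · exact hY2 i (by simp [hi, hiU, hir]) x hx
  have hYmin : IsMinSep f v r Y :=
    ⟨hvY, hrY, fun S' h1 h2 => hYX.trans (hX.2.2 S' h1 h2)⟩
  have hother : ∀ i, i ≠ ρ → i ≠ v → (a i = r ∨ b i = r) →
      (other a b r i ∈ Y ↔ other a b r i ∈ X) := fun i hi hiv hir =>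
    hY i hi hiv hir _ (hT.other_mem_branch hi)
  -- An edge not at `r` lies within one branch, which `Y` does not cut.
  have hedge : ∀ i, i ≠ ρ → i ≠ v → a i ≠ r → b i ≠ r → (a i ∈ Y ↔ b i ∈ Y) := by
    intro i hi hiv har hbr
    obtain ⟨j, hj, hjr, hij⟩ := hT.exists_mem_branch har
    have hjv : j ≠ v := by
      rintro rfl
      have h1 : a i = j := by simpa [branch, ← hr, hDv] using hij
      exact (hleaf i hi hiv).1 h1
    rw [hY j hj hjv hjr _ hij,
      hY j hj hjv hjr _ ((hT.mem_branch_iff hj hi (by grind)).1 hij)]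
  have hne : ∀ i, i ≠ ρ → a i ≠ b i := fun i hi h1 => hT.notMem i hi (h1 ▸ hT.mem i hi)
  -- The other sides survive: each has `r` and `v` on the same side, so moving an end from `r` to
  -- `v` does not affect it.
  refine ⟨Function.update D v Y, ⟨⟨?_, ?_, ?_, ?_⟩, ?_, ?_, ?_, ?_, ?_⟩⟩
  · intro i hi
    by_cases hiv : i = v
    · subst hiv; simp [splitHead, hbv, hvY]
    · have := hT.mem i hi
      have := hvD i hi hiv
      simp only [Function.update_of_ne hiv]
      grind [splitHead]
  · intro i hi
    by_cases hiv : i = v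
    · subst hiv; simp [splitTail, ← hr, hrY]
    · have := hT.notMem i hi
      have := hvD i hi hiv
      simp only [Function.update_of_ne hiv]
      grind [splitTail]
  · intro i hi j hj hij
    by_cases hiv : i = v
    · subst hiv
      simp only [Function.update_self]
      have := hedge j hj hij
      have := hother j hj hij
      have := hne j hj
      grind [splitTail, splitHead, other]
    · simp only [Function.update_of_ne hiv]
      have := hvD i hi hiv
      have := hT.mem_iff i hi j hj hij
      grind [splitTail, splitHead]
  · intro S hS
    refine hT.conn S fun i hi => ?_
    have h1 := hS v hvρ
    have h2 := hS i hi
    have := hne i hi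
    grind [splitTail, splitHead]
  · exact fun i hi => h.ne_root i (Finset.mem_of_mem_erase hi)
  · intro i hi
    have h1 := h.head_eq i (Finset.mem_of_mem_erase hi)
    have h2 := h.ne_of_mem i (Finset.mem_of_mem_erase hi) v hvρ (Finset.ne_of_mem_erase hi).symm
    grind [splitHead]
  · intro i hi
    rw [Function.update_of_ne (Finset.ne_of_mem_erase hi)]
    exact h.side_eq i (Finset.mem_of_mem_erase hi)
  · intro i hi j hj hij
    have h1 := h.ne_of_mem i (Finset.mem_of_mem_erase hi) j hj hij
    have h2 := Finset.ne_of_mem_erase hi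
    grind [splitHead, splitTail]
  · intro i hi hiU
    by_cases hiv : i = v
    · subst hiv
      simpa [splitHead, splitTail, hbv, ← hr] using hYmin
    · have hmin := h.isMinSep i hi (by simpa [hiv] using hiU)
      rw [Function.update_of_ne hiv]
      -- A set `Z` separating `x` from `v` either omits `r`, and then costs at least `S`, or
      -- contains `r`, and then its complement separates `v` from `r` and costs at least `Y`, which
      -- in turn separates `x` from `r`.
      have move : ∀ x S, IsMinSep f x r S → v ∉ S → x ∈ Y → IsMinSep f x v S := by
        intro x S hS hvS hxY
        refine ⟨hS.1, hvS, fun Z hxZ hvZ => ?_⟩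
        by_cases hrZ : r ∈ Z
        · rw [← hf.compl Z]
          exact (hS.2.2 Y hxY hrY).trans (hYmin.2.2 _ (by simpa using hvZ) (by simpa using hrZ))
        · exact hS.2.2 Z hxZ hrZ
      have h1 := hvD i hi hiv
      have h2 := hother i hi hiv
      have h3 := hne i hi
      by_cases ha : a i = r ∧ b i ∈ X
      · have hA : splitTail v X a b i = v := by simp [splitTail, hiv, ← hr, ha]
        have hB : splitHead v X a b i = b i := by grind [splitHead]
        rw [hA, hB]
        refine move _ _ (ha.1 ▸ hmin) ?_ (by grind [other])
        rw [← h1, ← ha.1]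
        exact hmin.2.1
      by_cases hb : b i = r ∧ a i ∈ X
      · have hA : splitHead v X a b i = v := by simp [splitHead, hiv, ← hr, hb]
        have hB : splitTail v X a b i = a i := by grind [splitTail]
        rw [hA, hB, ← IsMinSep.compl_iff hf]
        refine move _ _ ((hb.1 ▸ hmin).compl hf) ?_ (by grind [other])
        rw [Finset.mem_compl, not_not, ← h1, ← hb.1]
        exact hmin.1
      · have hA : splitTail v X a b i = a i := by grind [splitTail]
        have hB : splitHead v X a b i = b i := by grind [splitHead]
        rwa [hA, hB]

theorem exists_isPartialCutTree_empty [AddCommGroup α] [LinearOrder α] [IsOrderedAddMonoid α]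
    {f : Finset V → α} (hf : IsSymmSubmodular f) (ρ : V) :
    ∃ a b D, IsPartialCutTree f ρ ∅ a b D := by
  suffices H : ∀ U a b D, IsPartialCutTree f ρ U a b D → ∃ a b D, IsPartialCutTree f ρ ∅ a b D from
    H _ _ _ _ (isPartialCutTree_star f ρ)
  intro U
  induction U using Finset.strongInduction with
  | H U ih =>
    intro a b D h
    obtain rfl | ⟨v, hv⟩ := U.eq_empty_or_nonempty
    · exact ⟨a, b, D, h⟩
    · have hva : v ≠ a v := by
        have := h.notMem v (h.ne_root v hv)
        rw [h.side_eq v hv] at this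
        simpa [eq_comm] using this
      obtain ⟨X, hX⟩ := exists_isMinSep f hva
      obtain ⟨D', hD'⟩ := h.split hf hv hX
      exact ih _ (Finset.erase_ssubset hv) _ _ _ hD'

end EdgeArray

/-! ### Sides of tree edges and centroids -/

section TreeSide

variable {V : Type*} [Fintype V] {T : SimpleGraph V}

theorem mem_treeSide {t s v : V} :
    v ∈ treeSide T t s ↔ (T.deleteEdges {s(t, s)}).Reachable s v := by
  simp [treeSide]

theorem self_mem_treeSide (t s : V) : s ∈ treeSide T t s :=
  mem_treeSide.2 (SimpleGraph.Reachable.refl s)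

theorem mem_treeSide_iff_of_adj {t s x y : V} (h : T.Adj x y) (hne : s(x, y) ≠ s(t, s)) :
    x ∈ treeSide T t s ↔ y ∈ treeSide T t s := by
  have hadj : (T.deleteEdges {s(t, s)}).Adj x y := by simpa [h] using hne
  rw [mem_treeSide, mem_treeSide]
  exact ⟨fun h1 => h1.trans hadj.reachable, fun h1 => h1.trans hadj.symm.reachable⟩

omit [Fintype V] in
theorem SimpleGraph.Connected.mem_of_forall_adj (hT : T.Connected) {S : Finset V}
    (hS : ∀ x y, T.Adj x y → x ∈ S → y ∈ S) {x : V} (hx : x ∈ S) (y : V) : y ∈ S := by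
  obtain ⟨p⟩ := hT.preconnected x y
  induction p with
  | nil => exact hx
  | cons h _ ih => exact ih (hS _ _ h hx)

variable (hT : T.IsTree)
include hT

theorem SimpleGraph.IsTree.notMem_treeSide {t s : V} (h : T.Adj t s) : t ∉ treeSide T t s := by
  rw [mem_treeSide, SimpleGraph.reachable_comm]
  exact SimpleGraph.isBridge_iff.1 (SimpleGraph.isAcyclic_iff_forall_adj_isBridge.1 hT.isAcyclic h)

theorem SimpleGraph.IsTree.treeSide_compl [DecidableEq V] {t s : V} (h : T.Adj t s) :
    (treeSide T t s)ᶜ = treeSide T s t := by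
  have hcover := fun y => hT.connected.mem_of_forall_adj
    (S := treeSide T t s ∪ treeSide T s t) (fun x y hxy hx => by
      by_cases he : s(x, y) = s(t, s)
      · rcases Sym2.eq_iff.1 he with ⟨rfl, rfl⟩ | ⟨rfl, rfl⟩ <;> simp [self_mem_treeSide]
      · have he' : s(x, y) ≠ s(s, t) := by rwa [Sym2.eq_swap (a := s)]
        simpa [mem_treeSide_iff_of_adj hxy he, mem_treeSide_iff_of_adj hxy he'] using hx)
    (x := s) (by simp [self_mem_treeSide]) y
  ext y
  refine ⟨fun hy => ?_, fun hy => ?_⟩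
  · have := hcover y
    simp_all
  · rw [Finset.mem_compl]
    intro hy'
    apply hT.notMem_treeSide h
    rw [mem_treeSide] at hy hy' ⊢
    rw [Sym2.eq_swap] at hy
    exact hy'.trans hy.symm

/-- If both ends were on one side, a walk avoiding the edge would shorten to a path between them,
and by uniqueness of paths in a tree this is `p`, which uses the edge. -/
theorem SimpleGraph.IsTree.notMem_treeSide_of_dart_mem {s t : V} {p : T.Walk s t} (hp : p.IsPath)
    {d : T.Dart} (hd : d ∈ p.darts) (hs : s ∈ treeSide T d.snd d.fst) :
    t ∉ treeSide T d.snd d.fst := by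
  classical
  intro ht
  rw [mem_treeSide] at hs ht
  obtain ⟨q, hq⟩ := SimpleGraph.reachable_deleteEdges_iff_exists_walk.1 (hs.symm.trans ht)
  have hpq : q.bypass = p := congrArg Subtype.val
    ((hT.isAcyclic.subsingleton_path s t).elim ⟨q.bypass, q.bypass_isPath⟩ ⟨p, hp⟩)
  apply hq
  apply q.edges_bypass_subset_edges
  rw [hpq, Sym2.eq_swap]
  exact List.mem_map.2 ⟨d, hd, rfl⟩

/-- None of the four edge ends lies in the intersection, so no tree edge leaves it; if it were
nonempty, it would be everything. -/
theorem SimpleGraph.IsTree.treeSide_corner [DecidableEq V] {t s t' s' : V} (h : T.Adj t s)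
    (h' : T.Adj t' s') (hne : s(t, s) ≠ s(t', s')) (hs : s ∉ treeSide T t' s')
    (hs' : s' ∉ treeSide T t s) : Disjoint (treeSide T t s) (treeSide T t' s') := by
  rw [Finset.disjoint_left]
  intro x hx hx'
  have ht : t ∉ treeSide T t' s' := by rwa [mem_treeSide_iff_of_adj h hne]
  have ht' : t' ∉ treeSide T t s := by rwa [mem_treeSide_iff_of_adj h' hne.symm]
  have := hT.connected.mem_of_forall_adj (S := treeSide T t s ∩ treeSide T t' s')
    (fun y z hyz hy => by
      by_cases h1 : s(y, z) = s(t, s)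
      · rcases Sym2.eq_iff.1 h1 with ⟨rfl, rfl⟩ | ⟨rfl, rfl⟩ <;> simp_all
      by_cases h2 : s(y, z) = s(t', s')
      · rcases Sym2.eq_iff.1 h2 with ⟨rfl, rfl⟩ | ⟨rfl, rfl⟩ <;> simp_all
      rw [Finset.mem_inter] at hy ⊢
      rwa [← mem_treeSide_iff_of_adj hyz h1, ← mem_treeSide_iff_of_adj hyz h2])
    (x := x) (by simp [hx, hx']) s
  simp [hs] at this

/-- A shortest walk from `t` to the root avoids `s`, which is farther away, and so survives the
removal of the edge. -/
theorem SimpleGraph.IsTree.root_notMem_treeSide [DecidableEq V] {r t s : V} (h : T.Adj t s)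
    (hd : T.dist r s = T.dist r t + 1) : r ∉ treeSide T t s := by
  obtain ⟨p, hp⟩ := hT.connected.exists_walk_length_eq_dist t r
  have hsp : s ∉ p.support := by
    intro hsp
    have h1 := SimpleGraph.dist_le (p.dropUntil s hsp)
    have h2 := p.length_dropUntil_le_length hsp
    rw [SimpleGraph.dist_comm] at h1 hp
    rw [SimpleGraph.dist_comm (u := r) (v := t)] at hd
    have h3 := SimpleGraph.dist_comm (G := T) (u := r) (v := t)
    omega
  rw [← Finset.mem_compl, hT.treeSide_compl h, mem_treeSide,
    SimpleGraph.reachable_deleteEdges_iff_exists_walk]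
  exact ⟨p, fun he => hsp (p.fst_mem_support_of_mem_edges he)⟩

/-- A tree has a vertex that is contained in each side with more than half of the vertices. -/
theorem SimpleGraph.IsTree.exists_centroid [DecidableEq V] [Nonempty V] :
    ∃ r : V, ∀ t s, T.Adj t s → r ∉ treeSide T t s →
      2 * (treeSide T t s).card ≤ Fintype.card V := by
  classical
  obtain hP | hP := (Finset.univ.filter fun p : V × V =>
    T.Adj p.1 p.2 ∧ Fintype.card V < 2 * (treeSide T p.1 p.2).card).eq_empty_or_nonempty
  · refine ⟨Classical.arbitrary V, fun t s h _ => ?_⟩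
    by_contra! h1
    have : (t, s) ∈ (∅ : Finset (V × V)) := hP ▸ by simp [h, h1]
    simp at this
  -- The centroid is the head of a smallest side with more than half of the vertices. Another such
  -- side missing it would be strictly inside this one, against minimality, or disjoint from it,
  -- against counting.
  · obtain ⟨⟨t, s⟩, hts, hmin⟩ := Finset.exists_min_image _
      (fun p : V × V => (treeSide T p.1 p.2).card) hP
    simp only [Finset.mem_filter, Finset.mem_univ, true_and, Prod.forall] at hts hmin
    refine ⟨s, fun t' s' h' hs => ?_⟩
    by_contra! hbig
    have hne : s(t, s) ≠ s(t', s') := by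
      intro he
      rcases Sym2.eq_iff.1 he with ⟨rfl, rfl⟩ | ⟨rfl, rfl⟩
      · exact hs (self_mem_treeSide _ _)
      · have h1 := Finset.card_add_card_compl (treeSide T t s)
        rw [hT.treeSide_compl hts.1] at h1
        omega
    by_cases hs' : s' ∈ treeSide T t s
    · have ht' : t' ∈ treeSide T t s := by rwa [mem_treeSide_iff_of_adj h' hne.symm]
      have hd : Disjoint (treeSide T s t) (treeSide T t' s') := by
        refine hT.treeSide_corner hts.1.symm h' (by rwa [Sym2.eq_swap]) ?_ ?_
        · rwa [mem_treeSide_iff_of_adj hts.1 hne]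
        · rwa [← hT.treeSide_compl hts.1, Finset.mem_compl, not_not]
      rw [← hT.treeSide_compl hts.1, Finset.disjoint_left] at hd
      have hsub : treeSide T t' s' ⊂ treeSide T t s := by
        refine Finset.ssubset_iff_subset_ne.2 ⟨fun x hx => ?_, ?_⟩
        · by_contra hx'
          exact hd (by simpa using hx') hx
        · intro he
          exact hs (he ▸ self_mem_treeSide _ _)
      have := Finset.card_lt_card hsub
      have := hmin t' s' ⟨h', hbig⟩
      omega
    · have hd := hT.treeSide_corner hts.1 h' hne hs hs'
      have h1 := Finset.card_union_of_disjoint hd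
      have h2 := Finset.card_le_univ (treeSide T t s ∪ treeSide T t' s')
      omega

end TreeSide

/-! ### From edge arrays to trees -/

section EdgeGraph

variable {V : Type*} [Fintype V] [DecidableEq V] {ρ : V} {a b : V → V} {D : V → Finset V}

/-- The graph with the edges `{a i, b i}`, `i ≠ ρ`. -/
def edgeGraph (ρ : V) (a b : V → V) : SimpleGraph V :=
  SimpleGraph.fromEdgeSet {e | ∃ i, i ≠ ρ ∧ e = s(a i, b i)}

namespace IsEdgeTree

omit [Fintype V] [DecidableEq V] in
theorem adj (h : IsEdgeTree ρ a b D) {i : V} (hi : i ≠ ρ) : (edgeGraph ρ a b).Adj (a i) (b i) := by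
  have : a i ≠ b i := fun h1 => h.notMem i hi (h1 ▸ h.mem i hi)
  simpa [edgeGraph, this] using ⟨i, hi, Or.inl ⟨rfl, rfl⟩⟩

omit [Fintype V] [DecidableEq V] in
theorem mem_of_reachable (h : IsEdgeTree ρ a b D) {i x y : V} (hi : i ≠ ρ)
    (hxy : ((edgeGraph ρ a b).deleteEdges {s(a i, b i)}).Reachable x y) : x ∈ D i ↔ y ∈ D i := by
  obtain ⟨p⟩ := hxy
  induction p with
  | nil => rfl
  | cons hadj _ ih =>
    rw [← ih]
    simp only [edgeGraph, SimpleGraph.deleteEdges_adj, SimpleGraph.fromEdgeSet_adj,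
      Set.mem_ofPred_eq, Set.mem_singleton_iff] at hadj
    obtain ⟨⟨⟨j, hj, he⟩, -⟩, hne⟩ := hadj
    have hij : j ≠ i := by rintro rfl; exact hne he
    have := h.mem_iff i hi j hj hij
    rcases Sym2.eq_iff.1 he with ⟨rfl, rfl⟩ | ⟨rfl, rfl⟩
    · exact this
    · exact this.symm

theorem isTree (h : IsEdgeTree ρ a b D) : (edgeGraph ρ a b).IsTree := by
  classical
  have : Nonempty V := ⟨ρ⟩
  refine ⟨⟨fun x y => ?_⟩, SimpleGraph.isAcyclic_iff_forall_adj_isBridge.2 fun x y hxy => ?_⟩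
  · have := h.conn (Finset.univ.filter fun z => (edgeGraph ρ a b).Reachable x z) (fun i hi => by
      have := (h.adj hi).reachable
      simp only [Finset.mem_filter, Finset.mem_univ, true_and]
      exact ⟨fun h1 => h1.trans this, fun h1 => h1.trans this.symm⟩) x (by simp) y
    simpa using this
  · rw [SimpleGraph.isBridge_iff]
    simp only [edgeGraph, SimpleGraph.fromEdgeSet_adj, Set.mem_ofPred_eq] at hxy
    obtain ⟨⟨i, hi, he⟩, -⟩ := hxy
    intro hr
    rw [he] at hr
    have h1 := h.mem_of_reachable hi hr
    have h2 := h.mem i hi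
    have h3 := h.notMem i hi
    rcases Sym2.eq_iff.1 he with ⟨rfl, rfl⟩ | ⟨rfl, rfl⟩ <;> simp_all

theorem treeSide_eq (h : IsEdgeTree ρ a b D) {i : V} (hi : i ≠ ρ) :
    treeSide (edgeGraph ρ a b) (a i) (b i) = D i := by
  ext x
  refine ⟨fun hx => (h.mem_of_reachable hi (mem_treeSide.1 hx)).1 (h.mem i hi), fun hx => ?_⟩
  by_contra hx'
  rw [← Finset.mem_compl, h.isTree.treeSide_compl (h.adj hi), mem_treeSide,
    Sym2.eq_swap] at hx'
  exact h.notMem i hi ((h.mem_of_reachable hi hx').2 hx)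

end IsEdgeTree

theorem IsPartialCutTree.isMinSep_treeSide {α : Type*} [AddCommGroup α] [LinearOrder α]
    {f : Finset V → α} (hf : IsSymmSubmodular f)
    (h : IsPartialCutTree f ρ ∅ a b D) {t s : V} (hts : (edgeGraph ρ a b).Adj t s) :
    IsMinSep f s t (treeSide (edgeGraph ρ a b) t s) := by
  obtain ⟨⟨i, hi, he⟩, -⟩ := hts
  have h1 := h.isMinSep i hi (by simp)
  rcases Sym2.eq_iff.1 he with ⟨rfl, rfl⟩ | ⟨rfl, rfl⟩
  · rwa [h.treeSide_eq hi]
  · rw [← h.isTree.treeSide_compl (h.adj hi), h.treeSide_eq hi]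
    exact h1.compl hf

end EdgeGraph

/-! ### Source communities as least minimum cuts -/

namespace WeightedGraph

variable {V : Type*} [Fintype V] [DecidableEq V] (G : WeightedGraph V)

omit [Fintype V] [DecidableEq V] in
theorem cap_nonneg (u v : V) : 0 ≤ G.cap u v := by
  unfold cap
  split_ifs with h
  · exact (G.cost_pos _ (by simpa using h)).le
  · exact le_rfl

omit [Fintype V] [DecidableEq V] in
theorem cap_comm (u v : V) : G.cap u v = G.cap v u := by
  simp only [cap, Sym2.eq_swap (a := u)]
  by_cases h : G.graph.Adj u v
  · rw [if_pos h, if_pos h.symm]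
  · rw [if_neg h, if_neg fun h' => h h'.symm]

theorem isSymmSubmodular_cutCost : IsSymmSubmodular G.cutCost :=
  isSymmSubmodular_sum_sum_compl G.cap_comm G.cap_nonneg

variable {G}

theorem isMinCut_singleton {s t : V} {S : Finset V} :
    G.IsMinCut {s} {t} S ↔ IsMinSep G.cutCost s t S := by
  simp [IsMinCut, IsMinSep]

theorem isSC_singleton {s t : V} {S : Finset V} :
    G.IsSC s {t} S ↔
      IsMinSep G.cutCost s t S ∧ ∀ S', IsMinSep G.cutCost s t S' → S.card ≤ S'.card := by
  simp [IsSC, isMinCut_singleton]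

/-- Minimum s-t-cuts are closed under intersection, so smallest cardinality amounts to being least
under inclusion; this also makes the SC unique. -/
theorem IsSC.subset {s t : V} {S S' : Finset V} (h : G.IsSC s {t} S)
    (h' : IsMinSep G.cutCost s t S') : S ⊆ S' := by
  rw [isSC_singleton] at h
  have h1 := h.2 _ (h.1.inter G.isSymmSubmodular_cutCost h' h'.1 h.1.1 h.1.2.1)
  have h2 := Finset.eq_of_subset_of_card_le Finset.inter_subset_left h1
  exact h2 ▸ Finset.inter_subset_right

theorem IsSC.eq {s t : V} {S S' : Finset V} (h : G.IsSC s {t} S) (h' : G.IsSC s {t} S') : S = S' :=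
  (h.subset (isSC_singleton.1 h').1).antisymm (h'.subset (isSC_singleton.1 h).1)

theorem isSC_of_forall_subset {s t : V} {S : Finset V} (h : IsMinSep G.cutCost s t S)
    (hS : ∀ S', IsMinSep G.cutCost s t S' → S ⊆ S') : G.IsSC s {t} S :=
  isSC_singleton.2 ⟨h, fun S' h' => Finset.card_le_card (hS S' h')⟩

variable (G) in
theorem exists_isSC {s t : V} (h : s ≠ t) : ∃ S, G.IsSC s {t} S := by
  classical
  obtain ⟨S₀, h₀⟩ := exists_isMinSep G.cutCost h
  obtain ⟨S, hS, hmin⟩ := Finset.exists_min_image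
    (Finset.univ.filter fun S => IsMinSep G.cutCost s t S) Finset.card ⟨S₀, by simpa⟩
  simp only [Finset.mem_filter, Finset.mem_univ, true_and] at hS hmin
  exact ⟨S, isSC_singleton.2 ⟨hS, hmin⟩⟩

theorem mem_maximalSCs {S : Finset V} :
    S ∈ G.maximalSCs ↔ ∃ s t : V, s ≠ t ∧ G.IsSC s {t} S := by
  simp [maximalSCs]

end WeightedGraph

/-! ### Maximal source communities on cut tree edges -/

/-- Each maximal source community is given by an edge of an arbitrary cut tree. -/
theorem CutTree.mem_maximalSCs_iff {V : Type*} [Fintype V] [DecidableEq V] {G : WeightedGraph V}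
    (T : CutTree G) {S : Finset V} :
    S ∈ G.maximalSCs ↔ ∃ a b, T.tree.Adj a b ∧ G.IsSC a {b} S := by
  rw [WeightedGraph.mem_maximalSCs]
  refine ⟨?_, fun ⟨a, b, h, h'⟩ => ⟨a, b, h.ne, h'⟩⟩
  rintro ⟨s, t, hst, hSC⟩
  have hf := G.isSymmSubmodular_cutCost
  have hS := (WeightedGraph.isSC_singleton.1 hSC).1
  obtain ⟨p, hp⟩ := T.isTree.connected.exists_isPath s t
  -- Consider the vertices that no cut of cost at most c(S) separates from s. This set contains s
  -- and, because of S itself, not t, so the tree path has an edge leaving it.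
  obtain ⟨d, hd, ha, hb⟩ := p.exists_boundary_dart
    {u | ∀ Y : Finset V, G.cutCost Y ≤ G.cutCost S → (s ∈ Y ↔ u ∈ Y)} (by simp)
    (fun h => hS.2.1 ((h S le_rfl).1 hS.1))
  obtain ⟨W, hW⟩ : ∃ W, W = treeSide T.tree d.snd d.fst := ⟨_, rfl⟩
  have hWmin : IsMinSep G.cutCost d.fst d.snd W := by
    rw [hW, ← WeightedGraph.isMinCut_singleton]
    exact T.isMinCut _ _ d.adj.symm
  simp only [Set.mem_ofPred_eq, not_forall] at ha hb
  obtain ⟨Y, hYc, hY⟩ := hb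
  have hYab : ¬(d.fst ∈ Y ↔ d.snd ∈ Y) := by rwa [← ha Y hYc]
  have hWS : G.cutCost W ≤ G.cutCost S := by
    refine le_trans ?_ hYc
    by_cases h1 : d.fst ∈ Y
    · exact hWmin.2.2 _ h1 (by tauto)
    · rw [← hf.compl Y]
      exact hWmin.2.2 _ (by simpa using h1) (by simp; tauto)
  have hsW : s ∈ W := (ha W hWS).2 hWmin.1
  have htW : t ∉ W := by
    rw [hW] at hsW ⊢
    exact T.isTree.notMem_treeSide_of_dart_mem hp hd hsW
  have hWst : IsMinSep G.cutCost s t W :=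
    ⟨hsW, htW, fun S' h1 h2 => hWS.trans (hS.2.2 S' h1 h2)⟩
  have hSW := hSC.subset hWst
  refine ⟨d.fst, d.snd, d.adj, WeightedGraph.isSC_of_forall_subset
    ⟨(ha S le_rfl).1 hS.1, fun h => hWmin.2.1 (hSW h), fun S' h1 h2 =>
      (hS.2.2 W hsW htW).trans (hWmin.2.2 S' h1 h2)⟩ fun S' hS' => ?_⟩
  -- A competing minimum cut between the ends of the edge is cheap enough to keep s with the near
  -- end, so its intersection with `S` is again a minimum s-t-cut and hence contains `S`.
  have hS'c : G.cutCost S' ≤ G.cutCost S :=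
    (hS'.2.2 W hWmin.1 hWmin.2.1).trans hWS
  have := hSC.subset (hS.inter hf hS' ((ha S' hS'c).2 hS'.1) ((ha S le_rfl).1 hS.1)
    fun h => hWmin.2.1 (hSW h))
  exact this.trans Finset.inter_subset_right

/-! ### Special cut trees and the size of M(G) -/

section SpecialTree

variable {V : Type*} [Fintype V] [DecidableEq V]

/-- The cut cost with the product of the sizes of the two sides as a tie-breaker. -/
noncomputable def WeightedGraph.lexCost (G : WeightedGraph V) (S : Finset V) : ℝ ×ₗ ℝ :=
  toLex (G.cutCost S, (S.card : ℝ) * (Sᶜ.card : ℝ))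

/-- The tie-breaker is the cut function of the complete graph with unit costs, and componentwise
inequalities imply the lexicographic one. -/
theorem WeightedGraph.isSymmSubmodular_lexCost (G : WeightedGraph V) :
    IsSymmSubmodular G.lexCost where
  compl S := by
    simp only [lexCost, G.isSymmSubmodular_cutCost.compl, compl_compl, mul_comm]
  inter_add_union A B := by
    have h1 := G.isSymmSubmodular_cutCost.inter_add_union A B
    have h2 := (isSymmSubmodular_sum_sum_compl (V := V) (w := fun _ _ => 1) (fun _ _ => rfl)
      (fun _ _ => zero_le_one)).inter_add_union A B
    simp only [Finset.sum_const, nsmul_eq_mul, mul_one] at h2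
    simp only [lexCost, ← toLex_add, Prod.mk_add_mk]
    exact Prod.Lex.toLex_mono (Prod.mk_le_mk.2 ⟨h1, h2⟩)

theorem IsMinSep.of_lexCost {G : WeightedGraph V} {s t : V} {S : Finset V}
    (h : IsMinSep G.lexCost s t S) :
    IsMinSep G.cutCost s t S ∧ ∀ S', IsMinSep G.cutCost s t S' →
      (S.card : ℝ) * (Sᶜ.card : ℝ) ≤ (S'.card : ℝ) * (S'ᶜ.card : ℝ) := by
  have h1 : IsMinSep G.cutCost s t S := by
    refine ⟨h.1, h.2.1, fun S' hs ht => ?_⟩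
    have := h.2.2 S' hs ht
    exact (Prod.Lex.toLex_le_toLex'.1 this).1
  refine ⟨h1, fun S' h' => ?_⟩
  have := h.2.2 S' h'.1 h'.2.1
  exact (Prod.Lex.toLex_le_toLex'.1 this).2
    ((h1.2.2 S' h'.1 h'.2.1).antisymm (h'.2.2 S h.1 h.2.1))

/-- A minimum cut that is as unbalanced as possible is the smaller one of the two source
communities. -/
theorem IsMinSep.isSC_of_lexCost {G : WeightedGraph V} {s t : V} {S : Finset V}
    (h : IsMinSep G.lexCost s t S) (hcard : 2 * S.card ≤ Fintype.card V) :
    G.IsSC s {t} S ∧ ∀ S', G.IsSC t {s} S' → S.card ≤ S'.card := by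
  obtain ⟨h1, h2⟩ := h.of_lexCost
  have hf := G.isSymmSubmodular_cutCost
  -- The product x(|V| - x) is strictly increasing for x up to |V|/2, so a smaller set would have a
  -- smaller product.
  have key : ∀ x n : ℕ, x ≤ S.card → x + n = Fintype.card V →
      (S.card : ℝ) * (Sᶜ.card : ℝ) ≤ (x : ℝ) * (n : ℝ) → S.card ≤ x := by
    intro x n hx hn hle
    have h3 := Finset.card_add_card_compl S
    norm_cast at hle
    by_contra! hlt
    obtain ⟨k, hk⟩ := Nat.exists_eq_add_of_lt hlt
    obtain ⟨m, hm⟩ := Nat.exists_eq_add_of_le (show S.card ≤ Sᶜ.card by omega)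
    have hn' : n = S.card + m + k + 1 := by omega
    rw [hm, hn', hk] at hle
    nlinarith
  constructor
  · rw [WeightedGraph.isSC_singleton]
    refine ⟨h1, fun S' h' => ?_⟩
    by_contra! hlt
    exact hlt.not_ge (key _ _ hlt.le (Finset.card_add_card_compl S') (h2 S' h'))
  · intro S' h'
    by_contra! hlt
    refine hlt.not_ge (key _ _ hlt.le (Finset.card_add_card_compl S') ?_)
    have := h2 _ ((WeightedGraph.isSC_singleton.1 h').1.compl hf)
    rwa [compl_compl, mul_comm (S'ᶜ.card : ℝ)] at this

/-- The cut tree with a given underlying tree each of whose edges induces a minimum cut. -/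
noncomputable def CutTree.ofTree {G : WeightedGraph V} {T : SimpleGraph V} (hT : T.IsTree)
    (hmin : ∀ t s, T.Adj t s → IsMinSep G.cutCost s t (treeSide T t s)) : CutTree G where
  tree := T
  isTree := hT
  weight := Sym2.lift ⟨fun t s => open Classical in
    if T.Adj t s then G.cutCost (treeSide T t s) else 0, fun t s => by
      dsimp only
      by_cases hts : T.Adj t s
      · rw [if_pos hts, if_pos hts.symm, ← hT.treeSide_compl hts,
          G.isSymmSubmodular_cutCost.compl]
      · rw [if_neg hts, if_neg fun h => hts h.symm]⟩
  isMinCut t s hts := WeightedGraph.isMinCut_singleton.2 (hmin t s hts)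
  weight_eq t s hts := by simp [hts]

/-- Rooting at a centroid gives every side away from the root at most half of the vertices, as
`IsMinSep.isSC_of_lexCost` requires. -/
theorem nonempty_specialCutTree [Nonempty V] (G : WeightedGraph V) :
    Nonempty (SpecialCutTree G) := by
  obtain ⟨a, b, D, h⟩ :=
    exists_isPartialCutTree_empty G.isSymmSubmodular_lexCost (Classical.arbitrary V)
  have hT := h.isTree
  generalize hTe : edgeGraph (Classical.arbitrary V) a b = T at hT
  have hmin : ∀ t s, T.Adj t s → IsMinSep G.lexCost s t (treeSide T t s) := by
    intro t s hts
    rw [← hTe] at hts ⊢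
    exact h.isMinSep_treeSide G.isSymmSubmodular_lexCost hts
  obtain ⟨r, hr⟩ := hT.exists_centroid
  exact ⟨{
    CutTree.ofTree hT fun t s hts => (hmin t s hts).of_lexCost.1 with
    root := r
    isSC := fun t s hts hd =>
      ((hmin t s hts).isSC_of_lexCost (hr t s hts (hT.root_notMem_treeSide hts hd))).1
    card_le := fun t s hts hd =>
      ((hmin t s hts).isSC_of_lexCost (hr t s hts (hT.root_notMem_treeSide hts hd))).2 }⟩

theorem SpecialCutTree.mem_maximalSCs_iff_isArc {G : WeightedGraph V} (T : SpecialCutTree G)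
    {S : Finset V} : S ∈ G.maximalSCs ↔
      ∃ t s : V, T.IsArc t s ∧ (S = treeSide T.tree t s ∨ G.IsSC t {s} S) := by
  rw [T.mem_maximalSCs_iff]
  constructor
  · rintro ⟨a, b, hab, hS⟩
    rcases T.isTree.dist_eq_dist_add_one_of_adj T.root hab with hd | hd
    · exact ⟨b, a, ⟨hab.symm, hd⟩, Or.inl (hS.eq (T.isSC b a hab.symm hd))⟩
    · exact ⟨a, b, ⟨hab, hd⟩, Or.inr hS⟩
  · rintro ⟨t, s, ⟨hts, hd⟩, rfl | hS⟩
    · exact ⟨s, t, hts.symm, T.isSC t s hts hd⟩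
    · exact ⟨t, s, hts, hS⟩

/-- There is one SC for each orientation of each of the n-1 tree edges. -/
theorem CutTree.card_maximalSCs_le {G : WeightedGraph V} (T : CutTree G) :
    G.maximalSCs.card ≤ 2 * (Fintype.card V - 1) := by
  classical
  choose SC hSC using fun d : T.tree.Dart => G.exists_isSC d.adj.ne
  have hsub : G.maximalSCs ⊆ Finset.univ.image SC := by
    intro S hS
    obtain ⟨a, b, hab, hS⟩ := T.mem_maximalSCs_iff.1 hS
    exact Finset.mem_image.2 ⟨⟨(a, b), hab⟩, Finset.mem_univ _, (hSC ⟨(a, b), hab⟩).eq hS⟩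
  have h1 := (Finset.card_le_card hsub).trans Finset.card_image_le
  have h2 := T.tree.dart_card_eq_twice_card_edges
  have h3 := T.isTree.card_edgeFinset
  rw [Finset.card_univ] at h1
  omega

/-- The injection sends a non-root vertex to the side below its parent edge and the root to one of
its own SCs. The latter contains the root while the former do not, and sides below different edges
differ since an edge lies across its own side only. -/
theorem SpecialCutTree.card_le_card_maximalSCs (hV : 2 ≤ Fintype.card V) {G : WeightedGraph V}
    (T : SpecialCutTree G) : Fintype.card V ≤ G.maximalSCs.card := by
  have : Nontrivial V := Fintype.one_lt_card_iff_nontrivial.1 hV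
  have hpar : ∀ s, s ≠ T.root → ∃ t, T.IsArc t s := by
    intro s hs
    obtain ⟨p, hp⟩ := T.isTree.connected.exists_walk_length_eq_dist s T.root
    cases p with
    | nil => exact absurd rfl hs
    | @cons _ t _ hst q =>
      refine ⟨t, hst.symm, ?_⟩
      have h1 := SimpleGraph.dist_le q
      rw [SimpleGraph.Walk.length_cons, SimpleGraph.dist_comm] at hp
      rw [SimpleGraph.dist_comm] at h1
      have h2 := T.isTree.dist_eq_dist_add_one_of_adj T.root hst
      omega
  have key : ∀ s, ∃ S ∈ G.maximalSCs, if s = T.root then T.root ∈ S else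
      ∃ t, T.IsArc t s ∧ S = treeSide T.tree t s := by
    intro s
    split_ifs with hs
    · obtain ⟨x, hx⟩ := exists_ne T.root
      obtain ⟨S, hS⟩ := G.exists_isSC hx.symm
      exact ⟨S, WeightedGraph.mem_maximalSCs.2 ⟨_, _, hx.symm, hS⟩,
        (WeightedGraph.isSC_singleton.1 hS).1.1⟩
    · obtain ⟨t, ht⟩ := hpar s hs
      exact ⟨_, T.mem_maximalSCs_iff_isArc.2 ⟨t, s, ht, Or.inl rfl⟩, t, ht, rfl⟩
  choose F hF hF' using key
  rw [← Finset.card_univ]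
  refine Finset.card_le_card_of_injOn F (fun s _ => hF s) fun s _ s' _ he => ?_
  have hs := hF' s
  have hs' := hF' s'
  rw [he] at hs
  have hroot : ∀ t x, T.IsArc t x → T.root ∉ treeSide T.tree t x :=
    fun t x h => T.isTree.root_notMem_treeSide h.1 h.2
  split_ifs at hs hs' with h1 h2 h2
  · rw [h1, h2]
  · obtain ⟨t, ht, h3⟩ := hs'
    exact absurd (h3 ▸ hs) (hroot _ _ ht)
  · obtain ⟨t, ht, h3⟩ := hs
    exact absurd (h3 ▸ hs') (hroot _ _ ht)
  · obtain ⟨t, ht, h3⟩ := hs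
    obtain ⟨t', ht', h3'⟩ := hs'
    by_contra hne
    have hee : s(t', s') ≠ s(t, s) := by
      intro h4
      rcases Sym2.eq_iff.1 h4 with ⟨rfl, rfl⟩ | ⟨rfl, rfl⟩
      · exact hne rfl
      · have := ht.2
        have := ht'.2
        omega
    have h5 := mem_treeSide_iff_of_adj ht'.1 hee
    rw [← h3, h3'] at h5
    exact T.isTree.notMem_treeSide ht'.1 (h5.2 (self_mem_treeSide _ _))

end SpecialTree

/-! ### Maximum flows and source communities -/

section MaxFlow

variable {V : Type*} [Fintype V] {G : WeightedGraph V} {s t : V} {f : V → V → ℝ}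

namespace WeightedGraph

/-- The flows form a compact set, being closed in a box, and the value is continuous. -/
theorem exists_isMaxFlow (G : WeightedGraph V) (s t : V) : ∃ f, G.IsMaxFlow s t f := by
  have hK : IsCompact {f | G.IsFlow s t f} := by
    refine (isCompact_Icc (a := fun u v => -G.cap v u) (b := G.cap)).of_isClosed_subset ?_ ?_
    · have : {f | G.IsFlow s t f} = {f : V → V → ℝ | ∀ u v, f u v = - f v u} ∩
          {f | ∀ u v, f u v ≤ G.cap u v} ∩ {f | ∀ v, v ≠ s → v ≠ t → ∑ w, f v w = 0} := by
        ext f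
        exact ⟨fun h => ⟨⟨h.1, h.2⟩, h.3⟩, fun h => ⟨h.1.1, h.1.2, h.2⟩⟩
      rw [this]
      simp only [Set.ofPred_forall]
      refine ((isClosed_iInter fun u => isClosed_iInter fun v => isClosed_eq ?_ ?_).inter
        (isClosed_iInter fun u => isClosed_iInter fun v => isClosed_le ?_ ?_)).inter
        (isClosed_iInter fun v => isClosed_iInter fun _ => isClosed_iInter fun _ =>
          isClosed_eq ?_ ?_) <;> fun_prop
    · intro f hf
      refine ⟨fun u v => ?_, hf.le_cap⟩
      have := hf.le_cap v u
      have := hf.antisymm u v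
      linarith
  obtain ⟨f, hf, hmax⟩ := hK.exists_isMaxOn
    ⟨0, ⟨by simp, fun u v => by simpa using G.cap_nonneg u v, by simp⟩⟩
    (f := fun f => ∑ w, f s w) (by fun_prop)
  exact ⟨f, hf, fun g hg => hmax hg⟩

theorem IsFlow.reverse (hf : G.IsFlow s t f) : G.IsFlow t s fun u v => f v u where
  antisymm u v := hf.antisymm v u
  le_cap u v := by rw [G.cap_comm]; exact hf.le_cap v u
  conservation v h1 h2 := by
    have := hf.conservation v h2 h1
    simp_rw [hf.antisymm _ v, Finset.sum_neg_distrib, this, neg_zero]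

omit [Fintype V] in
theorem ResidualPath.of_reverse {u v : V}
    (h : G.ResidualPath (fun x y => f y x) u v) : G.ResidualPath f v u := by
  induction h with
  | refl => exact Relation.ReflTransGen.refl
  | tail _ h ih =>
    refine Relation.ReflTransGen.head ?_ ih
    rwa [G.cap_comm]

omit [Fintype V] in
theorem residualPath_reverse {u v : V} :
    G.ResidualPath (fun x y => f y x) u v ↔ G.ResidualPath f v u :=
  ⟨.of_reverse, fun h => .of_reverse (f := fun x y => f y x) h⟩

theorem IsFlow.sum_cut [DecidableEq V] (hf : G.IsFlow s t f) {S : Finset V} (hs : s ∈ S)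
    (ht : t ∉ S) : ∑ u ∈ S, ∑ v ∈ Sᶜ, f u v = ∑ w, f s w := by
  have h1 : ∑ u ∈ S, ∑ v, f u v = ∑ w, f s w := by
    refine Finset.sum_eq_single_of_mem s hs fun v hv hvs => hf.conservation v hvs ?_
    rintro rfl
    exact ht hv
  have h2 : ∑ u ∈ S, ∑ v ∈ S, f u v = 0 := by
    have h3 : ∑ u ∈ S, ∑ v ∈ S, f u v = ∑ u ∈ S, ∑ v ∈ S, -f u v := by
      rw [Finset.sum_comm]
      exact Finset.sum_congr rfl fun u _ => Finset.sum_congr rfl fun v _ => hf.antisymm v u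
    simp only [Finset.sum_neg_distrib] at h3
    linarith
  rw [← h1]
  simp_rw [← Finset.sum_add_sum_compl S (fun v => f _ v), Finset.sum_add_distrib, h2, zero_add]

theorem IsFlow.le_cutCost [DecidableEq V] (hf : G.IsFlow s t f) {S : Finset V} (hs : s ∈ S)
    (ht : t ∉ S) : ∑ w, f s w ≤ G.cutCost S := by
  rw [← hf.sum_cut hs ht]
  exact Finset.sum_le_sum fun u _ => Finset.sum_le_sum fun v _ => hf.le_cap u v

/-- Reversal turns the vertices that reach `t` into those reachable from `t`, so the second returned
set needs no separate treatment. -/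
theorem IsMaxFlow.reverse (hst : s ≠ t) (hf : G.IsMaxFlow s t f) :
    G.IsMaxFlow t s fun u v => f v u := by
  classical
  have hval : ∀ {s t : V} {g : V → V → ℝ}, s ≠ t → G.IsFlow s t g →
      ∑ w, g w t = ∑ w, g s w := by
    intro s t g hst hg
    have h1 := hg.sum_cut (S := {t}ᶜ) (by simpa using hst) (by simp)
    rw [compl_compl] at h1
    simp only [Finset.sum_singleton] at h1
    rw [← h1, ← Finset.sum_compl_add_sum {t}]
    have := hg.antisymm t t
    simp only [Finset.sum_singleton]
    linarith
  refine ⟨hf.1.reverse, fun g hg => ?_⟩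
  rw [hval hst hf.1]
  have := hf.2 _ hg.reverse
  rwa [hval hst.symm hg] at this

/-- A unit of flow can be pushed infinitesimally along a residual path. -/
theorem ResidualPath.exists_direction [DecidableEq V] {u : V} (h : G.ResidualPath f s u) :
    ∃ g : V → V → ℝ, (∀ x y, g x y = - g y x) ∧ (∀ x y, f x y = G.cap x y → g x y ≤ 0) ∧
      ∀ x, ∑ y, g x y = (if x = s then 1 else 0) - (if x = u then 1 else 0) := by
  induction h with
  | refl => exact ⟨0, by simp, by simp, by simp⟩
  | @tail v u _ hvu ih =>
    obtain ⟨g, h1, h2, h3⟩ := ih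
    refine ⟨fun x y => g x y + ((if x = v then 1 else 0) * (if y = u then 1 else 0) -
      (if x = u then 1 else 0) * (if y = v then 1 else 0)), fun x y => ?_, fun x y hxy => ?_,
      fun x => ?_⟩
    · simp only [h1 x y]; ring
    · have := h2 x y hxy
      have h4 : ¬(x = v ∧ y = u) := by rintro ⟨rfl, rfl⟩; exact hvu.ne hxy
      dsimp only
      split_ifs <;> first | (exfalso; tauto) | (norm_num; linarith)
    · simp only [Finset.sum_add_distrib, Finset.sum_sub_distrib, h3, ← Finset.mul_sum,
        Finset.sum_ite_eq', Finset.mem_univ, if_true]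
      ring

theorem IsMaxFlow.not_residualPath (hst : s ≠ t) (hf : G.IsMaxFlow s t f) :
    ¬ G.ResidualPath f s t := by
  classical
  intro h
  obtain ⟨g, h1, h2, h3⟩ := h.exists_direction
  -- On saturated pairs the direction is nonpositive; on the finitely many others there is slack for
  -- small ε.
  have hev : ∀ᶠ ε in nhdsWithin (0 : ℝ) (Set.Ioi 0), ∀ x y, f x y + ε * g x y ≤ G.cap x y := by
    rw [Filter.eventually_all]
    intro x
    rw [Filter.eventually_all]
    intro y
    rcases (hf.1.le_cap x y).eq_or_lt with heq | hlt
    · filter_upwards [self_mem_nhdsWithin] with ε hε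
      have := mul_nonpos_of_nonneg_of_nonpos (le_of_lt hε) (h2 x y heq)
      linarith
    · refine Filter.Eventually.filter_mono nhdsWithin_le_nhds ?_
      have hc : Filter.Tendsto (fun ε : ℝ => f x y + ε * g x y) (nhds 0) (nhds (f x y)) := by
        have : Continuous fun ε : ℝ => f x y + ε * g x y := by fun_prop
        simpa using this.tendsto 0
      exact (hc.eventually_lt_const hlt).mono fun _ h => h.le
  obtain ⟨ε, hε, hpos⟩ := (hev.and self_mem_nhdsWithin).exists
  have hflow : G.IsFlow s t fun x y => f x y + ε * g x y := by
    refine ⟨fun x y => ?_, hε, fun v hvs hvt => ?_⟩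
    · rw [hf.1.antisymm x y, h1 x y]; ring
    · rw [Finset.sum_add_distrib, ← Finset.mul_sum, hf.1.conservation v hvs hvt, h3]
      simp [hvs, hvt]
  have := hf.2 _ hflow
  rw [Finset.sum_add_distrib, ← Finset.mul_sum, h3] at this
  simp only [if_true, if_neg hst] at this
  have : (0 : ℝ) < ε := hpos
  linarith

/-- All pairs leaving `A` are saturated, so its cost equals the flow value and it is a minimum cut.
Every minimum cut is saturated likewise, so no residual path from s leaves it, and it contains `A`.
-/
theorem IsMaxFlow.isSC [DecidableEq V] (hst : s ≠ t) (hf : G.IsMaxFlow s t f) {A : Finset V}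
    (hA : ∀ v, v ∈ A ↔ G.ResidualPath f s v) : G.IsSC s {t} A := by
  have hs : s ∈ A := (hA s).2 Relation.ReflTransGen.refl
  have ht : t ∉ A := fun h => hf.not_residualPath hst ((hA t).1 h)
  have hcost : G.cutCost A = ∑ w, f s w := by
    rw [← hf.1.sum_cut hs ht]
    refine Finset.sum_congr rfl fun u hu => Finset.sum_congr rfl fun v hv => ?_
    refine ((hf.1.le_cap u v).eq_or_lt.resolve_right fun hlt => ?_).symm
    rw [Finset.mem_compl, hA] at hv
    exact hv (((hA u).1 hu).tail hlt)
  have hmin : IsMinSep G.cutCost s t A :=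
    ⟨hs, ht, fun S' h1 h2 => hcost ▸ hf.1.le_cutCost h1 h2⟩
  refine isSC_of_forall_subset hmin fun S' hS' v hv => ?_
  have hsat : ∀ x ∈ S', ∀ y ∈ S'ᶜ, f x y = G.cap x y := by
    have h1 : ∑ u ∈ S', ∑ v ∈ S'ᶜ, f u v = ∑ u ∈ S', ∑ v ∈ S'ᶜ, G.cap u v := by
      rw [hf.1.sum_cut hS'.1 hS'.2.1, ← hcost]
      exact (hmin.2.2 _ hS'.1 hS'.2.1).antisymm (hS'.2.2 _ hs ht)
    have h2 := (Finset.sum_eq_sum_iff_of_le fun u _ =>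
      Finset.sum_le_sum fun v _ => hf.1.le_cap u v).1 h1
    exact fun x hx => (Finset.sum_eq_sum_iff_of_le fun v _ => hf.1.le_cap x v).1 (h2 x hx)
  have hpath := (hA v).1 hv
  induction hpath with
  | refl => exact hS'.1
  | @tail x y hx hxy ih =>
    by_contra hy
    exact hxy.ne (hsat x (ih ((hA x).2 hx)) y (by simpa using hy))

theorem IsMaxFlowAnswer.isSC [DecidableEq V] (hst : s ≠ t) {A B : Finset V}
    (h : G.IsMaxFlowAnswer s t A B) : G.IsSC s {t} A ∧ G.IsSC t {s} B := by
  obtain ⟨f, hf, hA, hB⟩ := h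
  exact ⟨hf.isSC hst hA, (hf.reverse hst).isSC hst.symm fun v =>
    (hB v).trans residualPath_reverse.symm⟩

theorem exists_isMaxFlowAnswer (G : WeightedGraph V) (s t : V) :
    ∃ A B, G.IsMaxFlowAnswer s t A B := by
  classical
  obtain ⟨f, hf⟩ := G.exists_isMaxFlow s t
  exact ⟨Finset.univ.filter fun v => G.ResidualPath f s v,
    Finset.univ.filter fun v => G.ResidualPath f v t, f, hf, by simp, by simp⟩

end WeightedGraph

end MaxFlow

/-! ### The algorithm and its number of max-flow computations -/

namespace MaxFlowAlgorithm

variable {V : Type*} [Fintype V] [DecidableEq V] {G : WeightedGraph V}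

omit [DecidableEq V] in
theorem constructs_output (F : Finset (Finset V)) (n : ℕ) : (output F).Constructs G F n := by
  refine ⟨⟨0, F, .output F⟩, fun k F' h => ?_⟩
  cases h
  exact ⟨rfl, n.zero_le⟩

theorem constructs_maxFlow {s t : V} {hst : s ≠ t} {next : Finset V → Finset V → MaxFlowAlgorithm V}
    {F : Finset (Finset V)} {n : ℕ}
    (h : ∀ A B, G.IsSC s {t} A → G.IsSC t {s} B → (next A B).Constructs G F n) :
    (maxFlow s t hst next).Constructs G F (n + 1) := by
  constructor
  · obtain ⟨A, B, hAB⟩ := G.exists_isMaxFlowAnswer s t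
    obtain ⟨k, F', hrun⟩ := (h A B (hAB.isSC hst).1 (hAB.isSC hst).2).1
    exact ⟨k + 1, F', .maxFlow s t hst next A B k F' hAB hrun⟩
  · intro k F' hrun
    cases hrun with
    | maxFlow _ _ _ _ A B k _ hAB hrun =>
      obtain ⟨h1, h2⟩ := (h A B (hAB.isSC hst).1 (hAB.isSC hst).2).2 k F' hrun
      exact ⟨h1, by omega⟩

/-- Compute both source communities for each edge `{a i, b i}`, `i ∈ l`, and add them to `F`. -/
def collect (a b : V → V) : List V → Finset (Finset V) → MaxFlowAlgorithm V
  | [], F => output F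
  -- The output `∅` is a dummy: tree edges have distinct ends.
  | i :: l, F => if h : a i = b i then output ∅ else
      maxFlow (a i) (b i) h fun A B => collect a b l (insert A (insert B F))

/-- Construct a cut tree with the vertices in the list as the not yet processed leaves, and then
compute the source communities for its edges. -/
noncomputable def cutTreeSCs (ρ : V) : List V → (V → V) → (V → V) → MaxFlowAlgorithm V
  | [], a, b => collect a b (Finset.univ.erase ρ).toList ∅
  -- Again a dummy branch. Any minimum cut is good enough for splitting, so the second returned set
  -- is discarded.
  | v :: l, a, b => if h : v = a v then output ∅ else
      maxFlow v (a v) h fun A _ => cutTreeSCs ρ l (splitTail v A a b) (splitHead v A a b)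

theorem collect_constructs {a b : V → V} (M : Finset (Finset V)) (l : List V)
    (F : Finset (Finset V)) (hl : ∀ i ∈ l, a i ≠ b i)
    (hM : ∀ S, S ∈ M ↔ S ∈ F ∨ ∃ i ∈ l, G.IsSC (a i) {b i} S ∨ G.IsSC (b i) {a i} S) :
    (collect a b l F).Constructs G M l.length := by
  induction l generalizing F with
  | nil =>
    have : M = F := by ext S; simp [hM]
    rw [this]
    exact constructs_output F _
  | cons i l ih =>
    rw [collect, dif_neg (hl i (by simp)), List.length_cons]
    refine constructs_maxFlow fun A B hA hB => ih _ (fun j hj => hl j (by simp [hj])) fun S => ?_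
    have h1 : G.IsSC (a i) {b i} S ↔ S = A := ⟨fun h => h.eq hA, fun h => h ▸ hA⟩
    have h2 : G.IsSC (b i) {a i} S ↔ S = B := ⟨fun h => h.eq hB, fun h => h ▸ hB⟩
    simp only [hM, List.mem_cons, exists_eq_or_imp, h1, h2, Finset.mem_insert]
    rw [← or_assoc, or_comm (a := S ∈ F), or_assoc (a := S = A)]

/-- One computation is charged to each unprocessed leaf, and the remaining |V| - 1 to the edges of
the finished cut tree. The sides `D` occur only in the invariant, not in the state of the algorithm.
-/
theorem cutTreeSCs_constructs {ρ : V} (l : List V) (hl : l.Nodup) (a b : V → V)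
    (D : V → Finset V) (h : IsPartialCutTree G.cutCost ρ l.toFinset a b D) :
    (cutTreeSCs ρ l a b).Constructs G G.maximalSCs (Fintype.card V - 1 + l.length) := by
  have hf := G.isSymmSubmodular_cutCost
  induction l generalizing a b D with
  | nil =>
    have hne : ∀ i, i ≠ ρ → a i ≠ b i := fun i hi h1 => h.notMem i hi (h1 ▸ h.mem i hi)
    have := collect_constructs (G := G) (a := a) (b := b) G.maximalSCs
      (Finset.univ.erase ρ).toList ∅ (by simpa using hne) fun S => by
        rw [(CutTree.ofTree h.isTree fun t s hts => h.isMinSep_treeSide hf hts).mem_maximalSCs_iff]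
        simp only [Finset.notMem_empty, false_or, Finset.mem_toList, Finset.mem_erase,
          Finset.mem_univ, and_true]
        constructor
        · rintro ⟨x, y, ⟨⟨i, hi, he⟩, -⟩, hS⟩
          rcases Sym2.eq_iff.1 he with ⟨rfl, rfl⟩ | ⟨rfl, rfl⟩
          · exact ⟨i, hi, Or.inl hS⟩
          · exact ⟨i, hi, Or.inr hS⟩
        · rintro ⟨i, hi, hS | hS⟩
          · exact ⟨_, _, h.adj hi, hS⟩
          · exact ⟨_, _, (h.adj hi).symm, hS⟩
    simpa [cutTreeSCs] using this
  | cons v l ih =>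
    have hv : v ∈ (v :: l).toFinset := by simp
    have hva : v ≠ a v := by
      have := h.notMem v (h.ne_root v hv)
      rw [h.side_eq v hv] at this
      simpa [eq_comm] using this
    rw [cutTreeSCs, dif_neg hva, List.length_cons, ← add_assoc]
    refine constructs_maxFlow fun A B hA _ => ?_
    obtain ⟨D', hD'⟩ := h.split hf hv (WeightedGraph.isSC_singleton.1 hA).1
    have hU : (v :: l).toFinset.erase v = l.toFinset := by
      ext x
      have := (List.nodup_cons.1 hl).1
      simp only [Finset.mem_erase, List.mem_toFinset, List.mem_cons]
      grind
    rw [hU] at hD'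
    exact ih (List.nodup_cons.1 hl).2 _ _ D' hD'

end MaxFlowAlgorithm

theorem theorem3 {V : Type*} [Fintype V] [DecidableEq V] (hV : 2 ≤ Fintype.card V) :
    (∀ G : WeightedGraph V,
      Fintype.card V ≤ G.maximalSCs.card ∧
      G.maximalSCs.card ≤ 2 * (Fintype.card V - 1) ∧
      Nonempty (SpecialCutTree G) ∧
      ∀ T : SpecialCutTree G, ∀ S : Finset V,
        S ∈ G.maximalSCs ↔
          ∃ t s : V, T.IsArc t s ∧ (S = treeSide T.tree t s ∨ G.IsSC t {s} S)) ∧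
    ∃ a : MaxFlowAlgorithm V, ∀ G : WeightedGraph V,
      a.Constructs G G.maximalSCs (2 * (Fintype.card V - 1)) := by
  have : Nonempty V := Fintype.card_pos_iff.1 (by omega)
  constructor
  · intro G
    obtain ⟨T⟩ := nonempty_specialCutTree G
    exact ⟨T.card_le_card_maximalSCs hV, T.card_maximalSCs_le, ⟨T⟩,
      fun T S => T.mem_maximalSCs_iff_isArc⟩
  · obtain ⟨ρ⟩ := this
    -- The start is the star centred at an arbitrary `ρ`, with its n-1 leaves unprocessed, so the
    -- total is (n-1) + (n-1).
    refine ⟨.cutTreeSCs ρ (Finset.univ.erase ρ).toList (fun _ => ρ) id, fun G => ?_⟩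
    have := MaxFlowAlgorithm.cutTreeSCs_constructs (G := G) (ρ := ρ)
      (Finset.univ.erase ρ).toList (Finset.nodup_toList _) (fun _ => ρ) id (fun i => {i})
      (by simpa using isPartialCutTree_star G.cutCost ρ)
    simpa [two_mul] using this
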